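/- For a prime $p$ and an integer $m\ge 0$ let $$S_p(m)=\#\{q\le m:\ q \text{ prime},\ q\ne 3,\ q\equiv -1 \pmod p\},$$ and for $n\ge 1$ let $\delta_p(n)=\max\{0,\,v_p(n)-S_p(n-1)\}$, where $v_p$ is the $p$-adic valuation. Let $(a_n)_{n\ge1}$ be given by $a_1=1$, $a_n=a_{n-1}+\operatorname{lcm}(n,a_{n-1})$ for $n\ge2$, and let $b_n=a_n/a_{n-1}-1$ for $n\ge 2$. (1) For every prime $p$ there is an integer $t\ge1$ such that $S_p(p^k-1)\ge k$ for all $k\ge t$. Let $t_0(p)$ be the least such $t$. The function $p\mapsto t_0(p)$ on the primes is computable (recursive). (2) For an integer $P_0\ge 2$ let $N^*(P_0)=\max\{p^{t_0(p)}:\ p \text{ prime},\ p\le P_0\}$. The function $P_0\mapsto N^*(P_0)$ is computable. For every integer $P_0\ge2$ and every $n\ge N^*(P_0)$, one has $\delta_p(n)=0$ for all primes $p\le P_0$, and every prime divisor of $b_n$ is larger than $P_0$. In particular, if $n\ge N^*(P_0)$ and $b_n$ is neither $1$ nor a prime, then $b_n$ is composed only of primes larger than $P_0$. -/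

import Mathlib

/-- The sequence `a 1 = 1`, `a n = a (n-1) + lcm (n, a (n-1))` for `n ≥ 2`.
The value at the unused index `0` is set to `1`. -/
def lcmSeq : ℕ → ℕ
  | 0 => 1
  | 1 => 1
  | n + 2 => lcmSeq (n + 1) + Nat.lcm (n + 2) (lcmSeq (n + 1))

/-- The increments `b n = a n / a (n-1) - 1`, for `n ≥ 2`. As `a (n-1)` divides `a n` and is
smaller than it, both the division and the subtraction are exact there. -/
def lcmIncr (n : ℕ) : ℕ := lcmSeq n / lcmSeq (n - 1) - 1

/-- The 1-hit stock: the number of primes `q ≤ m` with `q ≠ 3` and `q ≡ -1 (mod p)`. -/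
def oneHitStock (p m : ℕ) : ℕ :=
  ((Finset.Icc 1 m).filter fun q : ℕ => q.Prime ∧ q ≠ 3 ∧ (q : ℤ) ≡ -1 [ZMOD (p : ℤ)]).card

/-- The 1-hit deficit `max (0, v_p(n) - S_p(n-1))` for `n ≥ 1`; subtraction of natural numbers is
truncated at `0`, which is the maximum with `0`. -/
def oneHitDeficit (p n : ℕ) : ℕ := padicValNat p n - oneHitStock p (n - 1)

/-- The `t ≥ 1` from which on the stock below `p ^ k` is at least `k`. -/
def stableSet (p : ℕ) : Set ℕ :=
  {t | 1 ≤ t ∧ ∀ k, t ≤ k → k ≤ oneHitStock p (p ^ k - 1)}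

/-- The stable checkpoint `t₀(p)`: the least element of `stableSet p` (and `0` if that set is
empty). -/
noncomputable def stableCheckpoint (p : ℕ) : ℕ := sInf (stableSet p)

/-- The checkpoint bound `N*(P₀)`: the maximum of `p ^ t₀(p)` over the primes `p ≤ P₀` (and `0` if
there is no such prime, that is, for `P₀ < 2`). -/
noncomputable def checkpointBound (P₀ : ℕ) : ℕ :=
  ((Finset.Icc 1 P₀).filter Nat.Prime).sup fun p => p ^ stableCheckpoint p

/-! If `q ≠ 3` is prime, then `q` divides no earlier term, so `a_q = a_{q-1} (q + 1)`. Each prime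
`q` counted by `S_p(m)` thus puts a factor `p` into `a_m`, and `p ^ S_p(m) ∣ a_m`. Since `b_n = n /
gcd(n, a_{n-1})`, the bound `v_p(n) ≤ S_p(n-1)` removes `p` from `b_n`.

What remains is `S_p(p^k - 1) ≥ k` from an explicit `k` on; the bound then makes `t₀(p)` a bounded
search. For `p = 2` Bertrand's postulate suffices. For `p = 2d + 1` the proof is elementary. Prime
divisors of values of `cosPoly ℤ d` are `p` or `≡ ±1` mod `p`, and the value at `n` is `≡ -1` mod
`p` when `n - 2` is a nonresidue, so some prime divisor is `≡ -1`
(`exists_prime_dvd_and_dvd_add_one`). If fewer than `k` such primes lay below `p ^ k`, all could be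
avoided: the small ones by `n ≡ 2` modulo their product, where the value is `≡ p`, the others by
counting roots (`exists_prime_dvd_add_one_notMem`). This produces a further such prime below `p ^
k`, a contradiction. -/

open Polynomial

/-! ### Cosine polynomials and the primes dividing their values -/

/-- The polynomials with `u ^ k * F k (u + u⁻¹) = 1 + u + ⋯ + u ^ (2 * k)`. For an odd prime
`p = 2 * k + 1` this is the minimal polynomial of `2 * cos (2 * π / p)`. -/
noncomputable def cosPoly (R : Type*) [CommRing R] : ℕ → R[X]
  | 0 => 1
  | 1 => X + 1
  | k + 2 => X * cosPoly R (k + 1) - cosPoly R k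

section CosPoly

variable {R : Type*} [CommRing R]

theorem cosPoly_eval_add_two (k : ℕ) (x : R) :
    (cosPoly R (k + 2)).eval x = x * (cosPoly R (k + 1)).eval x - (cosPoly R k).eval x := by
  simp [cosPoly]

theorem cosPoly_eval_add_mul (u v : R) (h : u * v = 1) (k : ℕ) :
    u ^ k * (cosPoly R k).eval (u + v) * (u - 1) = u ^ (2 * k + 1) - 1 := by
  induction k using Nat.twoStepInduction with
  | zero => simp [cosPoly]
  | one =>
    simp only [cosPoly, eval_add, eval_X, eval_one]
    linear_combination (u - 1) * h
  | more k h1 h2 =>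
    rw [cosPoly_eval_add_two]
    linear_combination u * (u + v) * h2 - u ^ 2 * h1 + (u ^ (2 * k + 3) - 1) * h

theorem cosPoly_eval_intCast (k : ℕ) (n : ℤ) :
    (((cosPoly ℤ k).eval n : ℤ) : R) = (cosPoly R k).eval (n : R) := by
  induction k using Nat.twoStepInduction with
  | zero => simp [cosPoly]
  | one => simp [cosPoly]
  | more k h1 h2 => rw [cosPoly_eval_add_two, cosPoly_eval_add_two, ← h1, ← h2]; push_cast; ring

theorem cosPoly_eval_two (k : ℕ) : (cosPoly R k).eval 2 = 2 * k + 1 := by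
  induction k using Nat.twoStepInduction with
  | zero => simp [cosPoly]
  | one => simp [cosPoly]
  | more k h1 h2 => rw [cosPoly_eval_add_two, h1, h2]; push_cast; ring

theorem cosPoly_natDegree_le_and_coeff (k : ℕ) :
    (cosPoly R k).natDegree ≤ k ∧ (cosPoly R k).coeff k = 1 := by
  induction k using Nat.twoStepInduction with
  | zero => simp [cosPoly]
  | one =>
    refine ⟨?_, by simp [cosPoly, coeff_one]⟩
    simp only [cosPoly]
    compute_degree
  | more k h1 h2 =>
    simp only [cosPoly]
    constructor
    · refine (natDegree_sub_le _ _).trans (max_le ?_ (by omega))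
      exact natDegree_mul_le.trans (by have := natDegree_X_le (R := R); omega)
    · rw [coeff_sub, coeff_X_mul, h2.2, coeff_eq_zero_of_natDegree_lt (by omega), sub_zero]

theorem cosPoly_eval_two_of_eq {p d : ℕ} (hd : p = 2 * d + 1) :
    (cosPoly R d).eval 2 = p := by
  rw [cosPoly_eval_two, hd]; push_cast; ring

theorem cosPoly_ne_zero [Nontrivial R] (k : ℕ) : cosPoly R k ≠ 0 := by
  intro h
  have := (cosPoly_natDegree_le_and_coeff (R := R) k).2
  simp [h] at this

end CosPoly

theorem cosPoly_eval_pos_and_le (n : ℤ) (hn : 2 ≤ n) (k : ℕ) :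
    0 < (cosPoly ℤ k).eval n ∧ (cosPoly ℤ k).eval n ≤ (cosPoly ℤ (k + 1)).eval n := by
  induction k with
  | zero => simp [cosPoly]; omega
  | succ k ih =>
    refine ⟨by omega, ?_⟩
    rw [cosPoly_eval_add_two]
    nlinarith

theorem cosPoly_eval_le (n : ℤ) (hn : 2 ≤ n) (k : ℕ) :
    (cosPoly ℤ k).eval n ≤ (n + 1) ^ k := by
  induction k using Nat.twoStepInduction with
  | zero => simp [cosPoly]
  | one => simp [cosPoly]
  | more k h1 h2 =>
    have h3 := (cosPoly_eval_pos_and_le n hn k).1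
    have h4 := (cosPoly_eval_pos_and_le n hn (k + 1)).1
    rw [cosPoly_eval_add_two, pow_succ]
    nlinarith

theorem exists_mul_eq_one_add_eq {K : Type*} [Field K] [IsAlgClosed K] (n : K) :
    ∃ u v : K, u * v = 1 ∧ u + v = n := by
  obtain ⟨u, hu⟩ := IsAlgClosed.exists_root (X ^ 2 - C n * X + 1 : K[X]) (by
    have : (X ^ 2 - C n * X + 1 : K[X]).degree = 2 := by compute_degree!
    rw [this]; decide)
  refine ⟨u, n - u, ?_, by ring⟩
  simp [IsRoot] at hu
  linear_combination -hu

/-- Prime divisors of the values of `cosPoly`. -/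
theorem dvd_sub_one_or_dvd_add_one_of_dvd_cosPoly {p q d : ℕ} (hp : p.Prime) (hd : p = 2 * d + 1)
    (hq : q.Prime) (hqp : q ≠ p) {n : ℤ} (h : (q : ℤ) ∣ (cosPoly ℤ d).eval n) :
    p ∣ q - 1 ∨ p ∣ q + 1 := by
  have := Fact.mk hq
  have := Fact.mk hp
  let K := AlgebraicClosure (ZMod q)
  have : CharP K q := charP_of_injective_algebraMap (algebraMap (ZMod q) K).injective q
  obtain ⟨u, v, huv, hn⟩ := exists_mul_eq_one_add_eq (n : K)
  have hev : (cosPoly K d).eval (n : K) = 0 := by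
    rw [← cosPoly_eval_intCast]
    exact (CharP.intCast_eq_zero_iff K q _).2 h
  have h1 := cosPoly_eval_add_mul u v huv d
  rw [hn, hev, ← hd] at h1
  have hup : u ^ p = 1 := by linear_combination -h1
  have hu0 : u ≠ 0 := left_ne_zero_of_mul_eq_one huv
  have hu1 : u ≠ 1 := by
    rintro rfl
    have hv : v = 1 := by simpa using huv
    have h2 : (n : K) = 2 := by rw [← hn, hv]; norm_num
    rw [h2, cosPoly_eval_two_of_eq hd, CharP.cast_eq_zero_iff K q] at hev
    exact hqp ((Nat.prime_dvd_prime_iff_eq hq hp).1 hev)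
  have hord : orderOf u = p := orderOf_eq_prime hup hu1
  -- Frobenius fixes the integer `n`, so it permutes the roots `u`, `v = u⁻¹` of `X² - nX + 1`: `u ^
  -- q` is `u` or `u⁻¹`, while `u` has order `p`.
  have hfrob : (u ^ q) * (u ^ q) - n * u ^ q + 1 = 0 := by
    have h4 : u * u - n * u + 1 = 0 := by rw [← hn]; linear_combination -huv
    have h5 := congrArg (frobenius K q) h4
    simpa [frobenius_def, map_sub, map_add, map_mul, mul_pow, hq.ne_zero] using h5
  have hfac : (u ^ q - u) * (u ^ q - v) = 0 := by
    rw [← hn] at hfrob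
    linear_combination hfrob + huv
  rw [← hord]
  rcases mul_eq_zero.1 hfac with h6 | h6
  · left
    apply orderOf_dvd_of_pow_eq_one
    apply mul_right_cancel₀ hu0
    rw [← pow_succ, Nat.sub_add_cancel hq.one_le, one_mul]
    exact sub_eq_zero.1 h6
  · right
    apply orderOf_dvd_of_pow_eq_one
    rw [pow_succ, sub_eq_zero.1 h6, mul_comm, huv]

/-- With `u + u⁻¹ = 2 + s` one has `(u - 1)² = u s`, and in characteristic `p` also `u ^ p - 1 = (u
- 1) ^ p = (u s) ^ d (u - 1)`; cancel `u ^ d (u - 1)`. By Euler's criterion this gives `-1` at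
nonresidues. -/
theorem cosPoly_eval_two_add {p d : ℕ} [Fact p.Prime] (hd : p = 2 * d + 1) (s : ℤ)
    (hs : (s : ZMod p) ≠ 0) : (((cosPoly ℤ d).eval (2 + s) : ℤ) : ZMod p) = (s : ZMod p) ^ d := by
  let K := AlgebraicClosure (ZMod p)
  have : CharP K p := charP_of_injective_algebraMap (algebraMap (ZMod p) K).injective p
  apply (algebraMap (ZMod p) K).injective
  rw [map_pow, map_intCast, map_intCast, cosPoly_eval_intCast]
  obtain ⟨u, v, huv, hn⟩ := exists_mul_eq_one_add_eq (((2 + s : ℤ)) : K)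
  have h1 := cosPoly_eval_add_mul u v huv d
  rw [hn, ← hd] at h1
  have hu0 : u ≠ 0 := left_ne_zero_of_mul_eq_one huv
  have hsK : (s : K) = u + v - 2 := by rw [hn]; push_cast; ring
  have hs0 : (s : K) ≠ 0 := by
    intro h
    apply hs
    rw [CharP.intCast_eq_zero_iff K p] at h
    rwa [ZMod.intCast_zmod_eq_zero_iff_dvd]
  have hu1 : u - 1 ≠ 0 := by
    intro h
    have hu : u = 1 := sub_eq_zero.1 h
    have hv : v = 1 := by simpa [hu] using huv
    apply hs0
    rw [hsK, hu, hv]; norm_num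
  have h2 : u ^ p - 1 = (u - 1) ^ p := by rw [sub_pow_char, one_pow]
  have h3 : (u - 1) ^ 2 = u * s := by rw [hsK]; linear_combination -huv
  apply mul_left_cancel₀ (pow_ne_zero d hu0)
  apply mul_right_cancel₀ hu1
  have h4 : (u - 1) ^ p = (u - 1) ^ (2 * d + 1) := congrArg _ hd
  rw [h1, h2, h4, pow_succ, pow_mul, h3, mul_pow]

/-! ### The sieve for primes `≡ -1` modulo `p` -/

theorem intCast_modEq_neg_one_iff (q p : ℕ) : (q : ℤ) ≡ -1 [ZMOD (p : ℤ)] ↔ p ∣ q + 1 := by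
  rw [Int.modEq_comm, Int.modEq_iff_dvd, ← Int.natCast_dvd_natCast]
  simp

theorem exists_prime_dvd_and_dvd_add_one {p m : ℕ} (hp2 : 2 < p)
    (hm0 : m ≠ 0) (hm : (m : ZMod p) = -1)
    (h : ∀ q, q.Prime → q ∣ m → p ∣ q - 1 ∨ p ∣ q + 1) :
    ∃ q, q.Prime ∧ q ∣ m ∧ p ∣ q + 1 := by
  by_contra! hcon
  have h1 : (m : ZMod p) = 1 := by
    rw [← Nat.prod_primeFactorsList hm0, Nat.cast_list_prod]
    apply List.prod_eq_one
    intro x hx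
    obtain ⟨q, hq, rfl⟩ := List.mem_map.1 hx
    have hqp := Nat.prime_of_mem_primeFactorsList hq
    have hqd := Nat.dvd_of_mem_primeFactorsList hq
    have h2 := (h q hqp hqd).resolve_right (hcon q hqp hqd)
    have h3 := (ZMod.natCast_eq_zero_iff (q - 1) p).2 h2
    rw [Nat.cast_sub hqp.one_le, Nat.cast_one] at h3
    exact sub_eq_zero.1 h3
  have := Fact.mk hp2
  exact ZMod.neg_one_ne_one (n := p) (by rw [← hm, h1])

/-- There are at most `d` roots modulo `q`, and as `A` is invertible each root fixes one residue
class of `j`. -/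
theorem card_filter_dvd_cosPoly_le {q d : ℕ} (hq : q.Prime) (A B : ℤ) (hA : ¬ (q : ℤ) ∣ A)
    (J : ℕ) :
    ((Finset.range J).filter fun j : ℕ => (q : ℤ) ∣ (cosPoly ℤ d).eval (B + A * j)).card ≤
      d * (J / q + 1) := by
  have := Fact.mk hq
  have hcard : (cosPoly (ZMod q) d).roots.toFinset.card ≤ d :=
    (Multiset.toFinset_card_le _).trans
      ((card_roots' _).trans (cosPoly_natDegree_le_and_coeff d).1)
  rw [mul_comm]
  refine (Finset.card_le_mul_card_image_of_maps_to (t := (cosPoly (ZMod q) d).roots.toFinset)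
    (f := fun j : ℕ => (B : ZMod q) + A * j) ?_ (J / q + 1) ?_).trans
    (Nat.mul_le_mul_left _ hcard)
  · intro j hj
    have h1 := (Finset.mem_filter.1 hj).2
    rw [← ZMod.intCast_zmod_eq_zero_iff_dvd, cosPoly_eval_intCast] at h1
    simp only [Multiset.mem_toFinset, mem_roots (cosPoly_ne_zero (R := ZMod q) d), IsRoot]
    exact_mod_cast h1
  · intro b _
    rcases Finset.eq_empty_or_nonempty (Finset.filter (fun j : ℕ => (B : ZMod q) + A * j = b)
      ((Finset.range J).filter fun j : ℕ => (q : ℤ) ∣ (cosPoly ℤ d).eval (B + A * j))) with h0 | h0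
    · rw [h0]; simp
    obtain ⟨i, hi⟩ := h0
    have hib := (Finset.mem_filter.1 hi).2
    have hA0 : (A : ZMod q) ≠ 0 := by rwa [Ne, ZMod.intCast_zmod_eq_zero_iff_dvd]
    have hsub : Finset.filter (fun j : ℕ => (B : ZMod q) + A * j = b)
      ((Finset.range J).filter fun j : ℕ => (q : ℤ) ∣ (cosPoly ℤ d).eval (B + A * j)) ⊆
        (Finset.range J).filter fun j => j ≡ i [MOD q] := by
      intro j hj
      simp only [Finset.mem_filter] at hj ⊢
      refine ⟨hj.1.1, ?_⟩
      rw [← ZMod.natCast_eq_natCast_iff]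
      have h2 := hj.2.trans hib.symm
      exact mul_left_cancel₀ hA0 (add_left_cancel h2)
    refine (Finset.card_le_card hsub).trans ?_
    rw [← Nat.count_eq_card_filter_range, Nat.count_modEq_card _ hq.pos]
    split_ifs <;> omega

/-- A sieve step: primes `≡ -1` modulo `p` outside a given finite set. -/
theorem exists_prime_dvd_add_one_notMem {p d M J : ℕ} (hp : p.Prime) (hd : p = 2 * d + 1)
    (hM : p.Coprime M) (hM0 : 0 < M) (Q : Finset ℕ)
    (hQ : ∀ q ∈ Q, q.Prime ∧ ¬ q ∣ M * p) (hsum : ∑ q ∈ Q, d * (J / q + 1) < J) :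
    ∃ q, q.Prime ∧ p ∣ q + 1 ∧ ¬ q ∣ M ∧ q ∉ Q ∧ q ≤ (3 + M * (p * J)) ^ d := by
  have := Fact.mk hp
  have hp2 : 2 < p := by have := hp.two_le; omega
  have hMp : (M : ZMod p) ≠ 0 := by
    rw [Ne, ZMod.natCast_eq_zero_iff]
    intro h
    exact hp.one_lt.ne' (Nat.Coprime.eq_one_of_dvd hM h)
  obtain ⟨a, ha⟩ := FiniteField.exists_nonsquare (F := ZMod p) (by
    rw [ZMod.ringChar_zmod_n]; omega)
  have ha0 : a ≠ 0 := by rintro rfl; exact ha (IsSquare.zero)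
  have had : a ^ d = -1 := by
    have h1 : p / 2 = d := by omega
    have h2 := (ZMod.pow_div_two_eq_neg_one_or_one p ha0).resolve_left
      (fun h => ha ((ZMod.euler_criterion p ha0).2 h))
    rwa [h1] at h2
  -- Makes `n = 2 + M (m + p j)` satisfy `n ≡ 2` mod `M` and `n - 2 ≡ a` mod `p` for every `j`.
  set m := (a * (M : ZMod p)⁻¹).val with hm
  have hmlt : m < p := ZMod.val_lt _
  have hmM : (M : ZMod p) * m = a := by
    rw [hm, ZMod.natCast_zmod_val]; field_simp
  have hex : ∃ j ∈ Finset.range J, ∀ q ∈ Q,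
      ¬ (q : ℤ) ∣ (cosPoly ℤ d).eval ((2 + M * m : ℤ) + (M * p : ℤ) * j) := by
    by_contra! hcon
    have hsub : Finset.range J ⊆ Q.biUnion fun q => (Finset.range J).filter fun j : ℕ =>
        (q : ℤ) ∣ (cosPoly ℤ d).eval ((2 + M * m : ℤ) + (M * p : ℤ) * j) := by
      intro j hj
      obtain ⟨q, hq, h⟩ := hcon j hj
      exact Finset.mem_biUnion.2 ⟨q, hq, Finset.mem_filter.2 ⟨hj, h⟩⟩
    have h1 := (Finset.card_le_card hsub).trans Finset.card_biUnion_le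
    rw [Finset.card_range] at h1
    refine absurd (h1.trans (Finset.sum_le_sum fun q hq => ?_)) (not_le.2 hsum)
    exact card_filter_dvd_cosPoly_le (hQ q hq).1 _ _
      (fun h => (hQ q hq).2 (by exact_mod_cast h)) J
  obtain ⟨j, hj, hjQ⟩ := hex
  rw [Finset.mem_range] at hj
  set n : ℤ := (2 + M * m : ℤ) + (M * p : ℤ) * j with hn
  have hn2 : 2 ≤ n := by rw [hn]; nlinarith [show (0 : ℤ) ≤ M * m by positivity,
    show (0 : ℤ) ≤ M * p * j by positivity]
  have hpos := (cosPoly_eval_pos_and_le n hn2 d).1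
  obtain ⟨N, hN⟩ := Int.eq_ofNat_of_zero_le hpos.le
  have hN0 : N ≠ 0 := by rintro rfl; simp [hN] at hpos
  have hNp : (N : ZMod p) = -1 := by
    have h1 : n = 2 + (M * (m + p * j) : ℤ) := by rw [hn]; ring
    have h2 : ((M * (m + p * j) : ℤ) : ZMod p) = a := by push_cast; simp [hmM]
    have h3 := cosPoly_eval_two_add (p := p) hd (M * (m + p * j) : ℤ) (by rw [h2]; exact ha0)
    rw [h2, had, ← h1, hN] at h3
    exact_mod_cast h3
  have hdvd : ∀ q : ℕ, q ∣ N → (q : ℤ) ∣ (cosPoly ℤ d).eval n := fun q h => by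
    rw [hN]; exact Int.natCast_dvd_natCast.2 h
  have hNpn : ¬ p ∣ N := by
    intro h
    rw [(ZMod.natCast_eq_zero_iff N p).2 h] at hNp
    exact one_ne_zero (neg_eq_zero.1 hNp.symm)
  obtain ⟨q, hq, hqN, hqp⟩ := exists_prime_dvd_and_dvd_add_one hp2 hN0 hNp (fun q hq hqN =>
    dvd_sub_one_or_dvd_add_one_of_dvd_cosPoly hp hd hq (by rintro rfl; exact hNpn hqN)
      (hdvd q hqN))
  refine ⟨q, hq, hqp, ?_, fun h => hjQ q h (hdvd q hqN), ?_⟩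
  · intro hqM
    have := Fact.mk hq
    have h1 := (ZMod.intCast_zmod_eq_zero_iff_dvd _ q).2 (hdvd q hqN)
    rw [cosPoly_eval_intCast] at h1
    have h2 : (n : ZMod q) = 2 := by
      rw [hn]; push_cast; rw [(ZMod.natCast_eq_zero_iff M q).2 hqM]; ring
    rw [h2, cosPoly_eval_two_of_eq hd, ZMod.natCast_eq_zero_iff] at h1
    rw [(Nat.prime_dvd_prime_iff_eq hq hp).1 h1] at hqM
    exact hp.one_lt.ne' (Nat.Coprime.eq_one_of_dvd hM hqM)
  · have h1 : N ≤ (3 + M * (p * J)) ^ d := by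
      have h2 := cosPoly_eval_le n hn2 d
      rw [hN] at h2
      have h3 : n + 1 ≤ 3 + M * (p * J) := by
        have h4 : m + p * j ≤ p * J := by nlinarith
        have h5 : (M * (m + p * j) : ℤ) ≤ M * (p * J) := by exact_mod_cast Nat.mul_le_mul_left M h4
        rw [hn]; nlinarith
      have h6 : (n + 1) ^ d ≤ (3 + M * (p * J) : ℤ) ^ d := pow_le_pow_left₀ (by omega) h3 d
      exact_mod_cast h2.trans h6
    exact (Nat.le_of_dvd (Nat.pos_of_ne_zero hN0) hqN).trans h1

/-! ### Size estimates and the stock for odd `p` -/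

theorem pow_five_lt_three_pow {z : ℕ} (hz : 10 ≤ z) : z ^ 5 < 3 ^ (2 * z - 1) := by
  induction z, hz using Nat.le_induction with
  | base => norm_num
  | succ z hz ih =>
    have h1 : (6 * (z + 1)) ^ 5 ≤ (7 * z) ^ 5 := Nat.pow_le_pow_left (by omega) 5
    rw [mul_pow, mul_pow] at h1
    have h2 : 2 * (z + 1) - 1 = 2 * z - 1 + 2 := by omega
    rw [h2, pow_add]
    omega

theorem three_add_mul_lt_pow {p M z T : ℕ} (hp : 3 ≤ p) (hM : M ≤ 4 ^ z) (hz : 10 ≤ z)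
    (hT : T ≤ z * (z * (z + 1))) : 3 + M * (p * (z * T)) < p ^ (4 * z) := by
  have h1 : M ≤ p ^ (2 * z) := by
    refine hM.trans ?_
    rw [pow_mul]
    exact Nat.pow_le_pow_left (by nlinarith) z
  have h2 : z * T + 3 ≤ z ^ 5 := by
    have e1 : z * T ≤ z * (z * (z * (z + 1))) := Nat.mul_le_mul_left z hT
    have e2 : z * (z * z) * (z + 2) ≤ z * (z * z) * (z * z) :=
      Nat.mul_le_mul_left _ (by nlinarith)
    have e3 : 10 * (10 * 10) ≤ z * (z * z) := Nat.mul_le_mul hz (Nat.mul_le_mul hz hz)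
    have e4 : z * (z * z) * (z + 2) = z * (z * (z * (z + 1))) + z * (z * z) := by ring
    have e5 : z ^ 5 = z * (z * z) * (z * z) := by ring
    omega
  have h3 := pow_five_lt_three_pow hz
  have h4 : 3 ^ (2 * z - 1) ≤ p ^ (2 * z - 1) := Nat.pow_le_pow_left hp _
  have h5 : p ^ (4 * z) = p ^ (2 * z) * (p * p ^ (2 * z - 1)) := by
    rw [← pow_succ', ← pow_add]; congr 1; omega
  have hpz : 0 < p ^ (2 * z) := pow_pos (by omega) _
  rw [h5]
  calc 3 + M * (p * (z * T)) ≤ p ^ (2 * z) * (p * 3) + p ^ (2 * z) * (p * (z * T)) := by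
        refine add_le_add ?_ (Nat.mul_le_mul_right _ h1)
        nlinarith
    _ = p ^ (2 * z) * (p * (z * T + 3)) := by ring
    _ < p ^ (2 * z) * (p * p ^ (2 * z - 1)) := by
        refine Nat.mul_lt_mul_of_pos_left ?_ hpz
        exact Nat.mul_lt_mul_of_pos_left (by omega) (by omega)

/-- A weak Chebyshev bound: the product of these primes is at least `z ^ Q.card` and at most the
primorial, hence at most `4 ^ T`. -/
theorem card_le_of_primes_between {z T c : ℕ} (hz : 4 ^ c ≤ z) (Q : Finset ℕ)
    (hQ : ∀ q ∈ Q, q.Prime ∧ z ≤ q ∧ q ≤ T) : c * Q.card ≤ T := by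
  have h1 : z ^ Q.card ≤ ∏ q ∈ Q, q := by
    rw [← Finset.prod_const]
    exact Finset.prod_le_prod (fun _ _ => Nat.zero_le _) fun q hq => (hQ q hq).2.1
  have h2 : ∏ q ∈ Q, q ≤ primorial T := by
    refine Nat.le_of_dvd (primorial_pos T) (Finset.prod_dvd_prod_of_subset _ _ _ fun q hq => ?_)
    obtain ⟨h, -, h'⟩ := hQ q hq
    simp only [Finset.mem_filter, Finset.mem_range]
    exact ⟨by omega, h⟩
  have h3 : 4 ^ (c * Q.card) ≤ 4 ^ T := by
    rw [pow_mul]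
    exact ((Nat.pow_le_pow_left hz _).trans h1).trans (h2.trans (primorial_le_four_pow T))
  exact (Nat.pow_le_pow_iff_right (by norm_num)).1 h3

set_option maxHeartbeats 1000000 in
theorem le_oneHitStock_of_odd {p d k : ℕ} (hp : p.Prime) (hd : p = 2 * d + 1)
    (hk : 4 * d * 4 ^ (64 * d ^ 3) ≤ k) : k ≤ oneHitStock p (p ^ k - 1) := by
  by_contra! hlt
  have hd0 : 1 ≤ d := by have := hp.two_le; omega
  -- The new prime is below `(p ^ (4 * z)) ^ d`, so `4 * d * z ≤ k` keeps it below `p ^ k`.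
  set z := k / (4 * d) with hzdef
  have hz : 4 ^ (64 * d ^ 3) ≤ z := by
    rw [hzdef, Nat.le_div_iff_mul_le (by omega)]; linarith
  have hzk : 4 * d * z ≤ k := Nat.mul_div_le k (4 * d)
  have hkz : k < 4 * d * (z + 1) := by
    rw [mul_comm]; exact Nat.lt_mul_of_div_lt (Nat.lt_succ_self _) (by omega)
  have hdz : 64 * d < z := by
    have h1 : d ≤ d ^ 3 := Nat.le_self_pow (by norm_num) d
    have h2 : 64 * d ^ 3 < 4 ^ (64 * d ^ 3) := Nat.lt_pow_self (by norm_num)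
    omega
  set T := 4 * d * k with hT
  have hkT : k ≤ T := by rw [hT]; nlinarith
  have hzk' : z ≤ k := by nlinarith
  set Q₁ := (Finset.Icc 1 z).filter fun q : ℕ => q.Prime ∧ p ∣ q + 1 with hQ₁
  set M := ∏ q ∈ Q₁, q with hMdef
  set Q₂ := (Finset.Icc 1 (p ^ k - 1)).filter fun q : ℕ => q.Prime ∧ p ∣ q + 1 ∧ z < q with hQ₂
  have hne : ∀ q : ℕ, p ∣ q + 1 → q ≠ p := by
    rintro q h rfl
    exact hp.one_lt.ne' (Nat.dvd_one.1 ((Nat.dvd_add_right (dvd_refl q)).1 h))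
  have hM0 : 0 < M := Finset.prod_pos fun q hq => (Finset.mem_filter.1 hq).2.1.pos
  have hM : p.Coprime M := Nat.Coprime.prod_right fun q hq =>
    (Nat.coprime_primes hp (Finset.mem_filter.1 hq).2.1).2
      (hne q (Finset.mem_filter.1 hq).2.2).symm
  have hM4 : M ≤ 4 ^ z := by
    refine (Nat.le_of_dvd (primorial_pos z)
      (Finset.prod_dvd_prod_of_subset _ _ _ fun q hq => ?_)).trans (primorial_le_four_pow z)
    simp only [hQ₁, Finset.mem_filter, Finset.mem_Icc] at hq
    simp only [Finset.mem_filter, Finset.mem_range]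
    exact ⟨by omega, hq.2.1⟩
  have hdvdM : ∀ q : ℕ, q.Prime → q ∣ M → q ≤ z := by
    intro q hq h
    obtain ⟨r, hr, hqr⟩ := (hq.prime.dvd_finsetProd_iff _).1 h
    simp only [hQ₁, Finset.mem_filter, Finset.mem_Icc] at hr
    rw [(Nat.prime_dvd_prime_iff_eq hq hr.2.1).1 hqr]
    exact hr.1.2
  have hQ₂card : Q₂.card ≤ k := by
    refine (Finset.card_le_card ?_).trans hlt.le
    intro q hq
    simp only [hQ₂, Finset.mem_filter] at hq ⊢
    refine ⟨hq.1, hq.2.1, ?_, (intCast_modEq_neg_one_iff q p).2 hq.2.2.1⟩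
    omega
  have hsum : ∑ q ∈ Q₂, d * (z * T / q + 1) < z * T := by
    -- Primes up to `T` are sparse by the Chebyshev bound; those beyond `T` number at most `k = T /
    -- (4d)`. Each range costs about a quarter of `z * T`.
    rw [← Finset.sum_filter_add_sum_filter_not Q₂ (· ≤ T)]
    have hs : 64 * d ^ 3 * (Q₂.filter (· ≤ T)).card ≤ T := by
      refine card_le_of_primes_between hz _ fun q hq => ?_
      simp only [hQ₂, Finset.mem_filter] at hq
      exact ⟨hq.1.2.1, hq.1.2.2.2.le, hq.2⟩
    set s := (Q₂.filter (· ≤ T)).card with hsdef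
    have hs2 : 4 * d * s ≤ z := by
      have h1 : 16 * d ^ 2 * s ≤ k := by
        have : (4 * d) * (16 * d ^ 2 * s) ≤ (4 * d) * k := by rw [← hT]; linarith
        exact Nat.le_of_mul_le_mul_left this (by omega)
      have h2 : (4 * d) * (4 * d * s) < (4 * d) * (z + 1) := by
        refine lt_of_le_of_lt ?_ hkz; linarith
      have := Nat.lt_of_mul_lt_mul_left h2
      omega
    have hA : ∑ q ∈ Q₂.filter (· ≤ T), d * (z * T / q + 1) ≤ s * (d * (T + 1)) := by
      rw [hsdef, ← smul_eq_mul]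
      refine Finset.sum_le_card_nsmul _ _ _ fun q hq => ?_
      simp only [hQ₂, Finset.mem_filter] at hq
      refine Nat.mul_le_mul_left _ (Nat.add_le_add_right ?_ 1)
      exact (Nat.div_le_div_left hq.1.2.2.2.le (by omega)).trans
        (Nat.mul_div_cancel_left T (by omega)).le
    have hB : ∑ q ∈ Q₂.filter (¬ · ≤ T), d * (z * T / q + 1) ≤ k * (d * (z + 1)) := by
      refine (Finset.sum_le_card_nsmul _ _ (d * (z + 1)) fun q hq => ?_).trans
        (Nat.mul_le_mul_right _ ((Finset.card_filter_le _ _).trans hQ₂card))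
      simp only [Finset.mem_filter, not_le] at hq
      refine Nat.mul_le_mul_left _ (Nat.add_le_add_right ?_ 1)
      exact (Nat.div_le_div_left hq.2.le (by omega)).trans
        (Nat.mul_div_cancel z (by omega)).le
    refine lt_of_le_of_lt (add_le_add hA hB) ?_
    have e1 : 4 * (s * (d * (T + 1))) ≤ z * (T + 1) := by nlinarith
    have e2 : 4 * (k * (d * (z + 1))) = T * (z + 1) := by rw [hT]; ring
    nlinarith
  obtain ⟨q, hq, hqp, hqM, hqQ, hqle⟩ := exists_prime_dvd_add_one_notMem (J := z * T) hp hd hM hM0 Q₂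
    (fun q hq => by
      simp only [hQ₂, Finset.mem_filter] at hq
      refine ⟨hq.2.1, fun h => ?_⟩
      rcases (hq.2.1.dvd_mul).1 h with h | h
      · have := hdvdM q hq.2.1 h; omega
      · exact hne q hq.2.2.1 ((Nat.prime_dvd_prime_iff_eq hq.2.1 hp).1 h)) hsum
  have hsize := three_add_mul_lt_pow (by omega : 3 ≤ p) hM4 (by omega : 10 ≤ z) (T := T) (by
    rw [hT]
    exact Nat.mul_le_mul (by omega) (hkz.le.trans (Nat.mul_le_mul_right _ (by omega))))
  have hqk : q < p ^ k := by
    refine hqle.trans_lt ((Nat.pow_lt_pow_left hsize (by omega)).trans_le ?_)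
    rw [← pow_mul]
    exact Nat.pow_le_pow_right hp.pos (by linarith)
  apply hqQ
  simp only [hQ₂, Finset.mem_filter, Finset.mem_Icc]
  refine ⟨⟨hq.one_le, by omega⟩, hq, hqp, ?_⟩
  by_contra! hqz
  exact hqM (Finset.dvd_prod_of_mem _ (Finset.mem_filter.2
    ⟨Finset.mem_Icc.2 ⟨hq.one_le, hqz⟩, hq, hqp⟩))

/-! ### The stock for `p = 2` and the uniform bound -/

theorem oneHitStock_mono (p : ℕ) : Monotone (oneHitStock p) := fun _ _ h =>
  Finset.card_le_card (Finset.filter_subset_filter _ (Finset.Icc_subset_Icc_right h))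

theorem le_oneHitStock_two {k : ℕ} (hk : 4 ≤ k) : k ≤ oneHitStock 2 (2 ^ k - 1) := by
  induction k, hk using Nat.le_induction with
  | base => decide +kernel
  | succ k hk ih =>
    refine Nat.succ_le_of_lt (ih.trans_lt (Finset.card_lt_card ?_))
    -- Bertrand adds one odd prime per doubling; the base case is `5, 7, 11, 13`.
    obtain ⟨q, hq, h1, h2⟩ := Nat.exists_prime_lt_and_le_two_mul (2 ^ k) (by positivity)
    have h16 : 2 ^ 4 ≤ 2 ^ k := Nat.pow_le_pow_right (by norm_num) hk
    have hodd : q % 2 = 1 := (hq.eq_two_or_odd).resolve_left (by omega)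
    have h2k : 2 ^ (k + 1) = 2 * 2 ^ k := by ring
    rw [Finset.ssubset_iff_of_subset (Finset.filter_subset_filter _
      (Finset.Icc_subset_Icc_right (by omega)))]
    refine ⟨q, ?_, ?_⟩
    · rw [Finset.mem_filter, intCast_modEq_neg_one_iff, Finset.mem_Icc]
      exact ⟨⟨by omega, by omega⟩, hq, by omega, by omega⟩
    · simp only [Finset.mem_filter, Finset.mem_Icc]
      omega

/-- An explicit bound for the stable checkpoint. -/
def stableBound (p : ℕ) : ℕ := 4 * (p / 2) * 4 ^ (64 * (p / 2) ^ 3)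

theorem le_oneHitStock {p k : ℕ} (hp : p.Prime) (hk : stableBound p ≤ k) :
    k ≤ oneHitStock p (p ^ k - 1) := by
  rcases hp.eq_two_or_odd with rfl | h
  · refine le_oneHitStock_two (le_trans ?_ hk)
    simp only [stableBound]
    norm_num
  · exact le_oneHitStock_of_odd (d := p / 2) hp (by omega) hk

/-! ### Divisibility in the sequence -/

theorem lcmSeq_pos (n : ℕ) : 0 < lcmSeq n := by
  induction n using Nat.twoStepInduction with
  | zero => simp [lcmSeq]
  | one => simp [lcmSeq]
  | more n h1 h2 => simp only [lcmSeq]; omega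

theorem lcmSeq_succ {n : ℕ} (hn : 1 ≤ n) :
    lcmSeq (n + 1) = lcmSeq n * (1 + (n + 1) / Nat.gcd (n + 1) (lcmSeq n)) := by
  obtain ⟨m, rfl⟩ := Nat.exists_eq_add_of_le' hn
  rw [lcmSeq, Nat.lcm, Nat.mul_div_right_comm (Nat.gcd_dvd_left _ _)]
  ring

theorem lcmIncr_succ {n : ℕ} (hn : 1 ≤ n) :
    lcmIncr (n + 1) = (n + 1) / Nat.gcd (n + 1) (lcmSeq n) := by
  rw [lcmIncr, Nat.add_sub_cancel, lcmSeq_succ hn, Nat.mul_div_cancel_left _ (lcmSeq_pos n),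
    Nat.add_sub_cancel_left]

theorem lcmSeq_dvd_succ {n : ℕ} (hn : 1 ≤ n) : lcmSeq n ∣ lcmSeq (n + 1) :=
  ⟨_, lcmSeq_succ hn⟩

theorem two_dvd_lcmSeq {n : ℕ} (hn : 3 ≤ n) : 2 ∣ lcmSeq n := by
  induction n, hn using Nat.le_induction with
  | base => decide
  | succ n hn ih => exact ih.trans (lcmSeq_dvd_succ (by omega))

/-- A prime other than `3` does not divide the terms of smaller index. -/
theorem not_dvd_lcmSeq {q : ℕ} (hq : q.Prime) (h3 : q ≠ 3) {n : ℕ} (hn : 1 ≤ n) (hnq : n < q) :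
    ¬ q ∣ lcmSeq n := by
  induction n, hn using Nat.le_induction with
  | base => simpa [lcmSeq] using hq.ne_one
  | succ n hn ih =>
    rw [lcmSeq_succ hn, hq.dvd_mul]
    rintro (h | h)
    · exact ih (by omega) h
    · have h1 := Nat.le_of_dvd (Nat.add_pos_left one_pos _) h
      have h2 := Nat.div_le_self (n + 1) (Nat.gcd (n + 1) (lcmSeq n))
      -- Size forces `q = n + 2`, which needs gcd `1`; but `n + 1` and `lcmSeq n` are both even.
      have hqn : q = n + 2 := le_antisymm (by linarith) hnq
      have hn3 : 3 ≤ n := by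
        rcases hq.eq_two_or_odd with h' | h' <;> omega
      have hodd : q % 2 = 1 := hq.eq_two_or_odd.resolve_left (by omega)
      have hg : 2 ∣ Nat.gcd (n + 1) (lcmSeq n) :=
        Nat.dvd_gcd (by omega) (two_dvd_lcmSeq hn3)
      have hg0 : 0 < Nat.gcd (n + 1) (lcmSeq n) := Nat.gcd_pos_of_pos_left _ (Nat.succ_pos n)
      have h4 := Nat.div_le_div_left (a := n + 1) (Nat.le_of_dvd hg0 hg) (by norm_num)
      have h6 : (n + 1) / 2 ≤ n := by omega
      linarith

theorem dvd_lcmSeq_of_prime {q p : ℕ} (hq : q.Prime) (h3 : q ≠ 3) (hp : p ∣ q + 1) :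
    ∃ m, lcmSeq q = lcmSeq (q - 1) * (p * m) := by
  obtain ⟨n, rfl⟩ : ∃ n, q = n + 1 := ⟨q - 1, by have := hq.pos; omega⟩
  have hn : 1 ≤ n := by have := hq.two_le; omega
  obtain ⟨m, hm⟩ := hp
  refine ⟨m, ?_⟩
  have h1 := not_dvd_lcmSeq hq h3 hn (Nat.lt_succ_self n)
  rw [lcmSeq_succ hn, Nat.Coprime.gcd_eq_one ((hq.coprime_iff_not_dvd).2 h1), Nat.div_one,
    Nat.add_sub_cancel, ← hm]
  ring

/-- Every prime counted in the stock contributes a factor `p` to the sequence. -/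
theorem pow_oneHitStock_dvd_lcmSeq (p : ℕ) {m : ℕ} (hm : 1 ≤ m) :
    p ^ oneHitStock p m ∣ lcmSeq m := by
  induction m, hm using Nat.le_induction with
  | base =>
    have : oneHitStock p 1 = 0 := by
      rw [oneHitStock, Finset.card_eq_zero, Finset.filter_eq_empty_iff]
      intro q hq h
      have := h.1.two_le
      simp at hq
      omega
    simp [this]
  | succ m hm ih =>
    have hIcc : Finset.Icc 1 (m + 1) = insert (m + 1) (Finset.Icc 1 m) := by
      ext x; simp only [Finset.mem_Icc, Finset.mem_insert]; omega
    rw [oneHitStock, hIcc, Finset.filter_insert]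
    split_ifs with h
    · rw [Finset.card_insert_of_notMem (by simp)]
      obtain ⟨c, hc⟩ := dvd_lcmSeq_of_prime h.1 h.2.1 ((intCast_modEq_neg_one_iff _ _).1 h.2.2)
      rw [hc, pow_succ]
      exact mul_dvd_mul ih (dvd_mul_right p c)
    · exact ih.trans (lcmSeq_dvd_succ hm)

theorem not_dvd_lcmIncr {n r : ℕ} (hn : 2 ≤ n) (hr : r.Prime) (h0 : oneHitDeficit r n = 0) :
    ¬ r ∣ lcmIncr n := by
  obtain ⟨m, rfl⟩ := Nat.exists_eq_add_of_le' (show 1 ≤ n by omega)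
  have hm : 1 ≤ m := by omega
  have := Fact.mk hr
  rw [lcmIncr_succ hm]
  intro h
  have h1 : r ^ padicValNat r (m + 1) ∣ Nat.gcd (m + 1) (lcmSeq m) := by
    refine Nat.dvd_gcd pow_padicValNat_dvd (dvd_trans (pow_dvd_pow r ?_)
      (pow_oneHitStock_dvd_lcmSeq r hm))
    have h2 := Nat.sub_eq_zero_iff_le.1 h0
    simpa using h2
  have h2 := mul_dvd_mul h1 h
  rw [Nat.mul_div_cancel' (Nat.gcd_dvd_left _ _), ← pow_succ] at h2
  exact pow_succ_padicValNat_not_dvd (Nat.succ_ne_zero m) h2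

/-! ### Vanishing of the deficit past the checkpoint -/

theorem stableBound_succ_mem_stableSet {p : ℕ} (hp : p.Prime) :
    stableBound p + 1 ∈ stableSet p :=
  ⟨by omega, fun _ hk => le_oneHitStock hp (by omega)⟩

theorem isLeast_stableCheckpoint {p : ℕ} (hp : p.Prime) :
    IsLeast (stableSet p) (stableCheckpoint p) :=
  ⟨Nat.sInf_mem ⟨_, stableBound_succ_mem_stableSet hp⟩, fun _ h => Nat.sInf_le h⟩

theorem oneHitDeficit_eq_zero {p n : ℕ} (hp : p.Prime) (hn : p ^ stableCheckpoint p ≤ n) :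
    oneHitDeficit p n = 0 := by
  obtain ⟨ht, hst⟩ := (isLeast_stableCheckpoint hp).1
  have hn0 : n ≠ 0 := by have := pow_pos hp.pos (stableCheckpoint p); omega
  refine Nat.sub_eq_zero_of_le ?_
  -- Compare `n` with `p ^ v_p(n)` if the valuation has reached the checkpoint, otherwise with `p ^
  -- t₀(p)`.
  rcases le_total (stableCheckpoint p) (padicValNat p n) with h | h
  · have h1 : p ^ padicValNat p n ≤ n := Nat.le_of_dvd (Nat.pos_of_ne_zero hn0) pow_padicValNat_dvd
    exact (hst _ h).trans (oneHitStock_mono p (by omega))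
  · exact h.trans ((hst _ le_rfl).trans (oneHitStock_mono p (by omega)))

theorem pow_stableCheckpoint_le_checkpointBound {p P : ℕ} (hp : p.Prime) (hpP : p ≤ P) :
    p ^ stableCheckpoint p ≤ checkpointBound P :=
  Finset.le_sup (f := fun p => p ^ stableCheckpoint p)
    (Finset.mem_filter.2 ⟨Finset.mem_Icc.2 ⟨hp.one_le, hpP⟩, hp⟩)

/-! ### Primitive recursiveness -/

theorem Primrec.nat_pow : Primrec₂ ((· ^ ·) : ℕ → ℕ → ℕ) :=
  Primrec₂.unpaired'.1 Nat.Primrec.pow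

theorem PrimrecRel.nat_dvd : PrimrecRel ((· ∣ ·) : ℕ → ℕ → Prop) :=
  (Primrec.eq.comp (Primrec.nat_mod.comp .snd .fst) (.const 0)).of_eq fun _ =>
    (Nat.dvd_iff_mod_eq_zero).symm

theorem PrimrecPred.nat_prime : PrimrecPred Nat.Prime := by
  have h1 : PrimrecRel fun m n : ℕ => ¬ m ∣ n ∨ m = 1 :=
    (PrimrecPred.not (PrimrecRel.nat_dvd.comp .fst .snd)).or (Primrec.eq.comp .fst (.const 1))
  have h2 : PrimrecPred fun n : ℕ => 2 ≤ n ∧ ∀ m < n, ¬ m ∣ n ∨ m = 1 :=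
    (Primrec.nat_le.comp (.const 2) .id).and (h1.forall_lt.comp .id .id)
  refine h2.of_eq fun n => ?_
  rw [Nat.prime_def_lt]
  refine and_congr_right fun _ => forall₂_congr fun m _ => ?_
  tauto

theorem primrec₂_oneHitStock : Primrec₂ oneHitStock := by
  classical
  have h1 : PrimrecRel fun q p : ℕ => q.Prime ∧ q ≠ 3 ∧ p ∣ q + 1 :=
    (PrimrecPred.nat_prime.comp .fst).and
      ((PrimrecPred.not (Primrec.eq.comp .fst (.const 3))).and
        (PrimrecRel.nat_dvd.comp .snd (Primrec.succ.comp .fst)))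
  have h2 : Primrec₂ fun p m : ℕ =>
      ((List.range (m + 1)).filter fun q => q.Prime ∧ q ≠ 3 ∧ p ∣ q + 1).length :=
    Primrec.list_length.comp (h1.listFilter.comp
      (Primrec.list_range.comp (Primrec.succ.comp .snd)) .fst)
  refine h2.of_eq fun p m => ?_
  have h3 : ((Finset.range (m + 1)).filter fun q => q.Prime ∧ q ≠ 3 ∧ p ∣ q + 1).card =
      oneHitStock p m := by
    unfold oneHitStock
    congr 1
    ext q
    simp only [Finset.mem_filter, Finset.mem_range, Finset.mem_Icc, intCast_modEq_neg_one_iff]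
    constructor
    · rintro ⟨h, h'⟩; exact ⟨⟨h'.1.one_le, by omega⟩, h'⟩
    · rintro ⟨h, h'⟩; exact ⟨by omega, h'⟩
  rw [← h3]
  rfl

theorem primrec_stableBound : Primrec stableBound := by
  have h : Primrec fun p : ℕ => p / 2 := Primrec.nat_div.comp .id (.const 2)
  exact Primrec.nat_mul.comp (Primrec.nat_mul.comp (.const 4) h)
    (Primrec.nat_pow.comp (.const 4) (Primrec.nat_mul.comp (.const 64)
      (Primrec.nat_pow.comp h (.const 3))))

/-- The stable checkpoint, found by a bounded search: one more than the greatest `k` up to the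
explicit bound for which the stock below `p ^ k` is less than `k`. -/
def boundedCheckpoint (p : ℕ) : ℕ :=
  Nat.findGreatest (fun k => oneHitStock p (p ^ k - 1) < k) (stableBound p) + 1

theorem primrec_boundedCheckpoint : Primrec boundedCheckpoint := by
  have h : PrimrecRel fun p k : ℕ => oneHitStock p (p ^ k - 1) < k :=
    Primrec.nat_lt.comp (primrec₂_oneHitStock.comp .fst
      (Primrec.nat_sub.comp (Primrec.nat_pow.comp .fst .snd) (.const 1))) .snd
  exact Primrec.succ.comp (Primrec.nat_findGreatest primrec_stableBound h)

theorem boundedCheckpoint_eq {p : ℕ} (hp : p.Prime) :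
    boundedCheckpoint p = stableCheckpoint p := by
  refine IsLeast.unique (s := stableSet p) ⟨⟨Nat.succ_pos _, fun k hk => ?_⟩, fun t ht => ?_⟩
    (isLeast_stableCheckpoint hp)
  · rcases le_total k (stableBound p) with h | h
    · exact not_lt.1 (Nat.findGreatest_is_greatest
        (P := fun k => oneHitStock p (p ^ k - 1) < k) (Nat.lt_of_succ_le hk) h)
    · exact le_oneHitStock hp h
  · refine Nat.succ_le_of_lt ?_
    by_contra! hlt
    -- The default `0` of a failed search is excluded by `1 ≤ t`.
    have h0 : Nat.findGreatest (fun k => oneHitStock p (p ^ k - 1) < k) (stableBound p) ≠ 0 := by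
      have := ht.1; omega
    exact absurd (ht.2 _ hlt) (not_le.2 (Nat.findGreatest_of_ne_zero
      (P := fun k => oneHitStock p (p ^ k - 1) < k) rfl h0))

theorem primrec_checkpointBound : Primrec checkpointBound := by
  classical
  have h1 : PrimrecPred fun q : ℕ => q.Prime := PrimrecPred.nat_prime
  have h2 : Primrec₂ fun (_ : ℕ) (s : ℕ × ℕ) =>
      max s.1 (if s.2.Prime then s.2 ^ boundedCheckpoint s.2 else 0) := by
    have hs : Primrec fun x : ℕ × ℕ × ℕ => x.2.2 := Primrec.snd.comp .snd
    exact Primrec.nat_max.comp (Primrec.fst.comp .snd)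
      (Primrec.ite (h1.comp hs)
        (Primrec.nat_pow.comp hs (primrec_boundedCheckpoint.comp hs)) (.const 0))
  refine (Primrec.list_foldl (Primrec.list_range.comp Primrec.succ) (.const 0) h2).of_eq
    fun P => ?_
  have h3 : ∀ n : ℕ, (List.range (n + 1)).foldl (fun s q =>
      max s (if q.Prime then q ^ boundedCheckpoint q else 0)) 0 = checkpointBound n := by
    intro n
    induction n with
    | zero => simp [checkpointBound, Nat.not_prime_zero]
    | succ n ih =>
      have hIcc : Finset.Icc 1 (n + 1) = insert (n + 1) (Finset.Icc 1 n) := by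
        ext x; simp only [Finset.mem_Icc, Finset.mem_insert]; omega
      rw [List.range_succ, List.foldl_append, ih]
      simp only [List.foldl_cons, List.foldl_nil]
      unfold checkpointBound
      rw [hIcc, Finset.filter_insert]
      split_ifs with h
      · rw [Finset.sup_insert, boundedCheckpoint_eq h, max_comm]
      · simp
  exact h3 P

theorem theorem6p3 :
    -- for each prime `p` the stable checkpoint exists
    (∀ p : ℕ, p.Prime → IsLeast (stableSet p) (stableCheckpoint p)) ∧
    -- it is effectively computable: one recursive function yields it for every prime `p`
    (∃ f : ℕ → ℕ, Computable f ∧ ∀ p : ℕ, p.Prime → f p = stableCheckpoint p) ∧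
    -- the checkpoint bound is effectively computable
    Computable checkpointBound ∧
    -- beyond the bound, the small primes have no deficit
    (∀ P₀ : ℕ, 2 ≤ P₀ → ∀ n : ℕ, checkpointBound P₀ ≤ n →
      ∀ p : ℕ, p.Prime → p ≤ P₀ → oneHitDeficit p n = 0) ∧
    -- and all prime factors of the increment exceed `P₀`
    (∀ P₀ : ℕ, 2 ≤ P₀ → ∀ n : ℕ, checkpointBound P₀ ≤ n →
      ∀ r : ℕ, r.Prime → r ∣ lcmIncr n → P₀ < r) := by
  have hdef : ∀ P₀ n p : ℕ, checkpointBound P₀ ≤ n → p.Prime → p ≤ P₀ → oneHitDeficit p n = 0 :=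
    fun P₀ n p hn hp hpP =>
      oneHitDeficit_eq_zero hp ((pow_stableCheckpoint_le_checkpointBound hp hpP).trans hn)
  refine ⟨fun p hp => isLeast_stableCheckpoint hp,
    ⟨boundedCheckpoint, primrec_boundedCheckpoint.to_comp, fun p hp => boundedCheckpoint_eq hp⟩,
    primrec_checkpointBound.to_comp, fun P₀ _ n hn p hp hpP => hdef P₀ n p hn hp hpP,
    fun P₀ hP n hn r hr hrn => ?_⟩
  by_contra! hrP
  have hn2 : 2 ≤ n := by
    have h1 := pow_stableCheckpoint_le_checkpointBound Nat.prime_two hP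
    have h2 := (isLeast_stableCheckpoint Nat.prime_two).1.1
    have h3 : 2 ^ 1 ≤ 2 ^ stableCheckpoint 2 := Nat.pow_le_pow_right (by norm_num) h2
    omega
  exact not_dvd_lcmIncr hn2 hr (hdef P₀ n r hn hr hrP) hrn
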